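/- Let $X\subseteq\mathbb{R}^n$ be open and connected and set $\Omega=X\times(0,\infty)$. Suppose $u\in C^{2,1}(\Omega;\mathbb{R}^k)\cap C(\overline{\Omega};\mathbb{R}^k)$ satisfies in $\Omega$ the system $$u_t=D(x,t,u)\sum_{i,j}a_{ij}(x,t)\,u_{x_ix_j}+\sum_i M_i(x,t,u)\,u_{x_i}+\phi(x,t,u),$$ where the $a_{ij}$ are real-valued functions on $\Omega$, and $\phi$ (with values in $\mathbb{R}^k$) and $D$, $M_1,\dots,M_n$ (with values in the real $k\times k$ matrices) are functions on $\Omega\times\mathbb{R}^k$. Assume: - $\phi(x,t,z)$, $D(x,t,z)$ and each $M_i(x,t,z)$ are Lipschitz continuous in $z\in\mathbb{R}^k$, uniformly for $(x,t)$ in compact subsets of $\Omega$; - each $a_{ij}$ is locally bounded in $\Omega$, and $D$ and each $M_i$ are locally bounded in $\Omega\times\mathbb{R}^k$; - the matrix $\{a_{ij}(x,t)\}$ is symmetric and locally uniformly positive definite in $\Omega$, and $D(x,t,z)$ is locally uniformly positive definite in $\Omega\times\mathbb{R}^k$ (that is, on each compact set $C$ there is $c>0$ such that $\xi\cdot A\xi\ge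 c|\xi|^2$ for all vectors $\xi$, for the matrix $A$ at every point of $C$). Let $K\subseteq\mathbb{R}^k$ be a closed convex set. Call $\nu\in\mathbb{R}^k$ inward pointing at $v\in\partial K$ if $|\nu|=1$ and $\nu$ is the gradient of an affine function $\ell$ with $\ell\ge0$ on $K$ and $\ell(v)=0$. Assume that $K$ is compatible with the system: for all $(x,t)\in\Omega$, all $v\in\partial K$ and all $\nu$ inward pointing at $v$, one has $\phi(x,t,v)\cdot\nu\ge0$, and $\nu$ is a left eigenvector of $D(x,t,v)$ and of each $M_i(x,t,v)$. No regularity of $\partial K$ is assumed. If $u(x,t)\in K$ for all $(x,t)\in\Omega$ and $u(x_0,t_0)\in\partial K$ for some $(x_0,t_0)\in\Omega$, then $u(x,t)\in\partial K$ for all $(x,t)\in X\times[0,t_0]$. -/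

import Mathlib

open scoped NNReal InnerProductSpace

noncomputable section

namespace ConvexSMP

/-- The parabolic domain `Ω = X × (0, ∞)`. -/
def parabolicDomain {n : ℕ} (X : Set (EuclideanSpace ℝ (Fin n))) :
    Set (EuclideanSpace ℝ (Fin n) × ℝ) :=
  X ×ˢ Set.Ioi (0 : ℝ)

/-- The partial derivative `u_t`. -/
def partialT {n k : ℕ} (u : EuclideanSpace ℝ (Fin n) × ℝ → EuclideanSpace ℝ (Fin k))
    (p : EuclideanSpace ℝ (Fin n) × ℝ) : EuclideanSpace ℝ (Fin k) :=
  deriv (fun s => u (p.1, s)) p.2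

/-- The partial derivative `u_{x_i}`. -/
def partialX {n k : ℕ} (i : Fin n)
    (u : EuclideanSpace ℝ (Fin n) × ℝ → EuclideanSpace ℝ (Fin k))
    (p : EuclideanSpace ℝ (Fin n) × ℝ) : EuclideanSpace ℝ (Fin k) :=
  fderiv ℝ (fun y => u (y, p.2)) p.1 (EuclideanSpace.single i (1 : ℝ))

/-- The second partial derivative `u_{x_i x_j}`. -/
def partialXX {n k : ℕ} (i j : Fin n)
    (u : EuclideanSpace ℝ (Fin n) × ℝ → EuclideanSpace ℝ (Fin k)) :
    EuclideanSpace ℝ (Fin n) × ℝ → EuclideanSpace ℝ (Fin k) :=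
  partialX j (partialX i u)

/-- `u ∈ C^{2,1}(Ω; ℝ^k)` for an open set `Ω` of space-time: `u` is twice differentiable in `x`
and once in `t`, and `u`, `u_t`, `u_{x_i}`, `u_{x_i x_j}` are jointly continuous on `Ω`. -/
structure IsC21On {n k : ℕ} (u : EuclideanSpace ℝ (Fin n) × ℝ → EuclideanSpace ℝ (Fin k))
    (Ω : Set (EuclideanSpace ℝ (Fin n) × ℝ)) : Prop where
  contDiffAt_x : ∀ p ∈ Ω, ContDiffAt ℝ 2 (fun y => u (y, p.2)) p.1
  differentiableAt_t : ∀ p ∈ Ω, DifferentiableAt ℝ (fun s => u (p.1, s)) p.2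
  continuousOn : ContinuousOn u Ω
  continuousOn_t : ContinuousOn (partialT u) Ω
  continuousOn_x : ∀ i, ContinuousOn (partialX i u) Ω
  continuousOn_xx : ∀ i j, ContinuousOn (partialXX i j u) Ω

/-- The linear operator on Euclidean `ℝ^m` given by a matrix; its norm is the operator norm. -/
abbrev matOp {m : ℕ} (A : Matrix (Fin m) (Fin m) ℝ) :
    EuclideanSpace ℝ (Fin m) →L[ℝ] EuclideanSpace ℝ (Fin m) :=
  Matrix.toEuclideanCLM (n := Fin m) (𝕜 := ℝ) A

/-- `g(p, z)` is Lipschitz continuous in `z`, uniformly for `p` in compact subsets of `Ω`. -/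
def LipschitzLocUnif {Y Z G : Type*} [TopologicalSpace Y] [PseudoEMetricSpace Z]
    [PseudoEMetricSpace G] (Ω : Set Y) (g : Y → Z → G) : Prop :=
  ∀ C : Set Y, C ⊆ Ω → IsCompact C → ∃ L : ℝ≥0, ∀ p ∈ C, LipschitzWith L (g p)

/-- `g` is locally bounded in `S`: bounded on each compact subset of `S`. -/
def LocBoundedOn {Y G : Type*} [TopologicalSpace Y] [Norm G] (S : Set Y) (g : Y → G) : Prop :=
  ∀ C : Set Y, C ⊆ S → IsCompact C → ∃ B : ℝ, ∀ y ∈ C, ‖g y‖ ≤ B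

/-- The (not necessarily symmetric) matrix field `A` is locally uniformly positive definite in
`S`: on each compact subset of `S` there is `c > 0` with `ξ · A ξ ≥ c |ξ|²` for all `ξ`. -/
def LocUnifPosDefOn {Y : Type*} [TopologicalSpace Y] {m : ℕ} (S : Set Y)
    (A : Y → Matrix (Fin m) (Fin m) ℝ) : Prop :=
  ∀ C : Set Y, C ⊆ S → IsCompact C → ∃ c : ℝ, 0 < c ∧
    ∀ y ∈ C, ∀ ξ : EuclideanSpace ℝ (Fin m), c * ‖ξ‖ ^ 2 ≤ ⟪ξ, matOp (A y) ξ⟫_ℝ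

/-- `ℓ` is a supporting affine functional of `K` at `v`: it is nonnegative on `K`, vanishes at
`v`, and its (constant) gradient has length one. -/
structure IsSupportingAffineFunctional {k : ℕ} (K : Set (EuclideanSpace ℝ (Fin k)))
    (v : EuclideanSpace ℝ (Fin k)) (ℓ : EuclideanSpace ℝ (Fin k) →ᵃ[ℝ] ℝ) : Prop where
  nonneg : ∀ z ∈ K, 0 ≤ ℓ z
  eq_zero : ℓ v = 0
  norm_gradient : ∀ z, ‖gradient (fun y => ℓ y) z‖ = 1

/-- `ν` is an inward pointing (unit) vector of `K` at `v`: the gradient of a supporting affine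
functional of `K` at `v`. -/
def IsInwardPointing {k : ℕ} (K : Set (EuclideanSpace ℝ (Fin k)))
    (v ν : EuclideanSpace ℝ (Fin k)) : Prop :=
  ∃ ℓ : EuclideanSpace ℝ (Fin k) →ᵃ[ℝ] ℝ, IsSupportingAffineFunctional K v ℓ ∧
    ∀ z, gradient (fun y => ℓ y) z = ν

/-- `ν` is a left eigenvector of the matrix `A`. -/
def IsLeftEigenvector {k : ℕ} (A : Matrix (Fin k) (Fin k) ℝ)
    (ν : EuclideanSpace ℝ (Fin k)) : Prop :=
  ν ≠ 0 ∧ ∃ c : ℝ, Matrix.vecMul (fun i => ν i) A = c • (fun i => ν i)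

/-- `K` is compatible with `φ`, `D` and the `M_i` over `Ω`. -/
def IsCompatible {n k : ℕ} (Ω : Set (EuclideanSpace ℝ (Fin n) × ℝ))
    (K : Set (EuclideanSpace ℝ (Fin k)))
    (φ : EuclideanSpace ℝ (Fin n) × ℝ → EuclideanSpace ℝ (Fin k) → EuclideanSpace ℝ (Fin k))
    (D : EuclideanSpace ℝ (Fin n) × ℝ → EuclideanSpace ℝ (Fin k) →
      Matrix (Fin k) (Fin k) ℝ)
    (M : Fin n → EuclideanSpace ℝ (Fin n) × ℝ → EuclideanSpace ℝ (Fin k) →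
      Matrix (Fin k) (Fin k) ℝ) : Prop :=
  ∀ p ∈ Ω, ∀ v ∈ frontier K, ∀ ν, IsInwardPointing K v ν →
    0 ≤ ⟪φ p v, ν⟫_ℝ ∧ IsLeftEigenvector (D p v) ν ∧ ∀ i, IsLeftEigenvector (M i p v) ν

end ConvexSMP

end

open ConvexSMP

/-! ### Supporting hyperplanes and the distance to the complement of a convex set. -/

section Convex

/-! When `K` has interior and is not the whole space, the scalar function w = dist(u, Kᶜ) is
nonnegative and vanishes in Ω exactly where u lies in `frontier K`. The theorem is therefore a
strong minimum principle for w. As `frontier K` may be rough, w is only known to be continuous, and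
it is handled by touching functions in the viscosity manner.

At a point p, let v be a frontier point nearest to u(p) and ν an inward unit normal at v. The
function g = ⟨ν, u − v⟩ is as smooth as u, lies above w, and equals w at p. Since ν is a left
eigenvector of D and the M_i at v, pairing the system with ν yields a scalar parabolic inequality
for g at p. The system has its coefficients at u(p) instead of v, but the Lipschitz conditions bound
the error by a multiple of |u(p) − v| = w(p), a zero-order term (`exists_touchingSupersolution`).

Positivity of w then spreads forward in time. In a slanted tube around a space-time segment, an
explicit strict subsolution stays below w (`not_touchingSupersolution_of_barrier`,
`pos_of_segment_subset`), and connectedness of X chains such segments (`pos_of_isPreconnected`). So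
w > 0 at a time before t₀ would force w(x₀, t₀) > 0. -/

theorem infDist_compl_pos_iff {E : Type*} [PseudoMetricSpace E] {K : Set E} (hKcl : IsClosed K)
    (hne : (Kᶜ).Nonempty) {z : E}
    (hz : z ∈ K) : 0 < Metric.infDist z Kᶜ ↔ z ∉ frontier K := by
  rw [frontier_eq_closure_inter_closure, hKcl.closure_eq, Set.mem_inter_iff,
    ← Metric.infDist_pos_iff_notMem_closure hne]
  simp [hz]

variable {E : Type*} [NormedAddCommGroup E] [InnerProductSpace ℝ E]

/-- Hahn–Banach separates v from the open set `interior K`; the inequality passes to the closure of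
the interior, which is `K`. Strict separation from a nonempty interior makes the normal nonzero, so
it can be normalised. -/
theorem Convex.exists_unit_inner_nonneg_of_mem_frontier [CompleteSpace E] {K : Set E}
    (hKcl : IsClosed K) (hKcv : Convex ℝ K) (hint : (interior K).Nonempty) {v : E}
    (hv : v ∈ frontier K) : ∃ ν : E, ‖ν‖ = 1 ∧ ∀ y ∈ K, 0 ≤ ⟪ν, y - v⟫_ℝ := by
  obtain ⟨f, hf⟩ := geometric_hahn_banach_open_point hKcv.interior isOpen_interior hv.2
  set n := (InnerProductSpace.toDual ℝ E).symm f with hn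
  have hfn : ∀ y, f y = ⟪n, y⟫_ℝ := fun y => by simp [hn]
  have hn0 : n ≠ 0 := by
    intro h0
    obtain ⟨y, hy⟩ := hint
    have := hf y hy
    simp [hfn, h0] at this
  refine ⟨-((‖n‖)⁻¹ • n), ?_, fun y hy => ?_⟩
  · rw [norm_neg, norm_smul, norm_inv, norm_norm, inv_mul_cancel₀ (norm_ne_zero_iff.2 hn0)]
  · have hle : f y ≤ f v := by
      have hcl : closure (interior K) ⊆ {z | f z ≤ f v} :=
        closure_minimal (fun z hz => (hf z hz).le) (isClosed_le f.continuous continuous_const)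
      rw [hKcv.closure_interior_eq_closure_of_nonempty_interior hint, hKcl.closure_eq] at hcl
      exact hcl hy
    rw [inner_neg_left, real_inner_smul_left, inner_sub_right, ← hfn, ← hfn]
    have : 0 ≤ (‖n‖)⁻¹ := by positivity
    nlinarith

theorem closedBall_infDist_compl_subset {K : Set E} (hKcl : IsClosed K) {y : E} (hy : y ∈ K) :
    Metric.closedBall y (Metric.infDist y Kᶜ) ⊆ K := by
  rcases (Metric.infDist_nonneg (x := y) (s := Kᶜ)).eq_or_lt with h | h
  · rw [← h, Metric.closedBall_zero]
    simpa using hy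
  · rw [← closure_ball y h.ne']
    exact closure_minimal Metric.ball_infDist_compl_subset hKcl

/-- Moving from y by the distance to the complement in the direction −ν stays in `K`, and the
supporting inequality at the point reached is the claim. -/
theorem infDist_compl_le_inner {K : Set E} (hKcl : IsClosed K) {ν v : E} (hν : ‖ν‖ = 1)
    (h : ∀ y ∈ K, 0 ≤ ⟪ν, y - v⟫_ℝ) {y : E} (hy : y ∈ K) :
    Metric.infDist y Kᶜ ≤ ⟪ν, y - v⟫_ℝ := by
  have hmem : y - Metric.infDist y Kᶜ • ν ∈ K := by
    apply closedBall_infDist_compl_subset hKcl hy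
    rw [Metric.mem_closedBall, dist_eq_norm, sub_sub_cancel_left, norm_neg, norm_smul, hν, mul_one,
      Real.norm_of_nonneg Metric.infDist_nonneg]
  have := h _ hmem
  rw [sub_right_comm, inner_sub_right, real_inner_smul_right, real_inner_self_eq_norm_sq, hν] at this
  linarith

theorem exists_mem_frontier_dist_eq_infDist_compl [ProperSpace E] {K : Set E} (hKcl : IsClosed K)
    (hne : (Kᶜ).Nonempty) {z : E} (hz : z ∈ K) :
    ∃ v ∈ frontier K, ‖z - v‖ = Metric.infDist z Kᶜ := by
  obtain ⟨v, hv, hd⟩ := (isClosed_closure (s := Kᶜ)).exists_infDist_eq_dist hne.closure z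
  rw [Metric.infDist_closure] at hd
  refine ⟨v, ?_, by rw [hd, dist_eq_norm]⟩
  rw [frontier_eq_closure_inter_closure]
  refine ⟨subset_closure (closedBall_infDist_compl_subset hKcl hz ?_), hv⟩
  rw [Metric.mem_closedBall, hd, dist_comm]

theorem ConvexSMP.isInwardPointing_of_inner_nonneg {k : ℕ} {K : Set (EuclideanSpace ℝ (Fin k))}
    {v ν : EuclideanSpace ℝ (Fin k)} (hν : ‖ν‖ = 1) (h : ∀ y ∈ K, 0 ≤ ⟪ν, y - v⟫_ℝ) :
    IsInwardPointing K v ν := by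
  let ℓ : EuclideanSpace ℝ (Fin k) →ᵃ[ℝ] ℝ :=
    (innerSL ℝ ν).toLinearMap.toAffineMap - AffineMap.const ℝ _ ⟪ν, v⟫_ℝ
  have hℓ : ∀ y, ℓ y = ⟪ν, y - v⟫_ℝ := fun y => by simp [ℓ, inner_sub_right]
  have hg : ∀ z, gradient (fun y => ℓ y) z = ν := by
    intro z
    apply HasGradientAt.gradient
    rw [hasGradientAt_iff_hasFDerivAt]
    have h1 : HasFDerivAt (fun y => ⟪ν, y⟫_ℝ - ⟪ν, v⟫_ℝ) (innerSL ℝ ν) z :=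
      ((innerSL ℝ ν).hasFDerivAt).sub_const _
    simp only [hℓ, inner_sub_right]
    exact h1
  exact ⟨ℓ, ⟨fun z hz => by rw [hℓ]; exact h z hz, by simp [hℓ], fun z => by rw [hg, hν]⟩, hg⟩

end Convex

/-! ### Derivative tests at a minimum, restriction to lines, matrix factorisation. -/

section Calculus

/-- A negative second derivative would make s a local maximum as well, so h would be locally
constant and c would vanish. -/
theorem IsLocalMin.second_deriv_nonneg {h h' : ℝ → ℝ} {s c : ℝ} (hmin : IsLocalMin h s)
    (h1 : ∀ᶠ r in nhds s, HasDerivAt h (h' r) r) (h2 : HasDerivAt h' c s) : 0 ≤ c := by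
  by_contra! hc
  have hd : deriv h =ᶠ[nhds s] h' := h1.mono fun r hr => hr.deriv
  have hdd : deriv (deriv h) s = c := by rw [hd.deriv_eq, h2.deriv]
  have hmax : IsLocalMax h s := isLocalMax_of_deriv_deriv_neg (by rwa [hdd]) hmin.deriv_eq_zero
    h1.self_of_nhds.continuousAt
  have hconst : h =ᶠ[nhds s] fun _ => h s := by
    filter_upwards [hmin, hmax] with r hr1 hr2 using le_antisymm hr2 hr1
  have hz : deriv h =ᶠ[nhds s] fun _ => 0 := by
    simpa using hconst.deriv
  rw [hz.deriv_eq] at hdd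
  simp at hdd
  exact hc.ne hdd.symm

/-- Only earlier times are compared, because the minimum over the tube may sit at its final time. -/
theorem HasDerivAt.nonpos_of_eventually_le_left {h : ℝ → ℝ} {c t : ℝ} (hd : HasDerivAt h c t)
    (hle : ∀ᶠ s in nhdsWithin t (Set.Iio t), h t ≤ h s) : c ≤ 0 := by
  have h1 : Filter.Tendsto (slope h t) (nhdsWithin t (Set.Iio t)) (nhds c) :=
    (hasDerivAt_iff_tendsto_slope.1 hd).mono_left
      (nhdsWithin_mono t (fun s (hs : s < t) => hs.ne))
  refine le_of_tendsto h1 ?_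
  filter_upwards [hle, self_mem_nhdsWithin] with s hs hst
  rw [slope_def_field]
  exact div_nonpos_of_nonneg_of_nonpos (sub_nonneg.2 hs) (sub_nonpos.2 (le_of_lt hst))

variable {E F : Type*} [NormedAddCommGroup E] [NormedSpace ℝ E] [NormedAddCommGroup F]
  [NormedSpace ℝ F]

theorem hasDerivAt_line {f : E → F} {x b : E} {s : ℝ} (hf : DifferentiableAt ℝ f (x + s • b)) :
    HasDerivAt (fun r : ℝ => f (x + r • b)) (fderiv ℝ f (x + s • b) b) s := by
  have h1 : HasDerivAt (fun r : ℝ => x + r • b) b s := by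
    simpa using ((hasDerivAt_id s).smul_const b).const_add x
  exact hf.hasFDerivAt.comp_hasDerivAt s h1

theorem ContDiffAt.eventually_hasDerivAt_line {f : E → F} {x : E} (hf : ContDiffAt ℝ 2 f x)
    (b : E) : ∀ᶠ s : ℝ in nhds 0,
      HasDerivAt (fun r : ℝ => f (x + r • b)) (fderiv ℝ f (x + s • b) b) s := by
  have h1 : ∀ᶠ y in nhds x, DifferentiableAt ℝ f y :=
    (hf.eventually (by simp)).mono fun y hy => hy.differentiableAt (by simp)
  have h2 : Filter.Tendsto (fun r : ℝ => x + r • b) (nhds 0) (nhds x) := by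
    have : Continuous fun r : ℝ => x + r • b := by fun_prop
    simpa using this.tendsto 0
  exact (h2.eventually h1).mono fun s hs => hasDerivAt_line hs

theorem ContDiffAt.differentiableAt_fderiv {f : E → F} {x : E} (hf : ContDiffAt ℝ 2 f x) :
    DifferentiableAt ℝ (fderiv ℝ f) x :=
  (hf.fderiv_right (m := 1) (by norm_num)).differentiableAt (by simp)

theorem ContDiffAt.hasDerivAt_fderiv_line {f : E → F} {x : E} (hf : ContDiffAt ℝ 2 f x)
    (b : E) : HasDerivAt (fun r : ℝ => fderiv ℝ f (x + r • b) b)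
      (fderiv ℝ (fderiv ℝ f) x b b) 0 := by
  have h : HasDerivAt (fun r : ℝ => fderiv ℝ f (x + r • b))
      (fderiv ℝ (fderiv ℝ f) (x + (0 : ℝ) • b) b) 0 :=
    hasDerivAt_line (by simpa using hf.differentiableAt_fderiv)
  simpa using h.clm_apply (hasDerivAt_const 0 b)

end Calculus

/-- The factorisation turns Σ aᵢⱼ gᵢⱼ into a sum of second derivatives along the rows of B, so that
one-dimensional derivative tests suffice. -/
theorem Matrix.exists_transpose_mul_self {m : ℕ} {A : Matrix (Fin m) (Fin m) ℝ} (hs : A.IsSymm)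
    (hp : ∀ ξ : EuclideanSpace ℝ (Fin m), 0 ≤ ⟪ξ, matOp A ξ⟫_ℝ) :
    ∃ B : Matrix (Fin m) (Fin m) ℝ, ∀ i j, A i j = ∑ l, B l i * B l j := by
  have hA : A.PosSemidef := by
    refine Matrix.PosSemidef.of_dotProduct_mulVec_nonneg ?_ fun x => ?_
    · rw [Matrix.IsHermitian, Matrix.conjTranspose_eq_transpose_of_trivial]
      exact hs
    · have := hp (WithLp.toLp 2 x)
      rw [EuclideanSpace.inner_eq_star_dotProduct, Matrix.ofLp_toEuclideanCLM,
        dotProduct_comm] at this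
      exact this
  open scoped MatrixOrder in
  obtain ⟨B, hB⟩ := CStarAlgebra.nonneg_iff_eq_star_mul_self.1 hA.nonneg
  refine ⟨B, fun i j => ?_⟩
  rw [hB, Matrix.mul_apply]
  simp [Matrix.star_apply]

theorem ConvexSMP.partialXX_eq {n k : ℕ}
    {u : EuclideanSpace ℝ (Fin n) × ℝ → EuclideanSpace ℝ (Fin k)}
    {p : EuclideanSpace ℝ (Fin n) × ℝ} (h : ContDiffAt ℝ 2 (fun y => u (y, p.2)) p.1)
    (i j : Fin n) : partialXX i j u p = fderiv ℝ (fderiv ℝ (fun y => u (y, p.2))) p.1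
      (EuclideanSpace.single j (1 : ℝ)) (EuclideanSpace.single i (1 : ℝ)) := by
  have h1 := h.differentiableAt_fderiv.hasFDerivAt.clm_apply
    (hasFDerivAt_const (EuclideanSpace.single i (1 : ℝ)) p.1)
  simp only [partialXX, partialX]
  rw [h1.fderiv]
  simp

/-! ### The distance function as a supersolution of a scalar equation. -/

namespace ConvexSMP

theorem IsLeftEigenvector.exists_inner_matOp {k : ℕ} {A : Matrix (Fin k) (Fin k) ℝ}
    {ν : EuclideanSpace ℝ (Fin k)} (h : IsLeftEigenvector A ν) :
    ∃ c : ℝ, ∀ ξ, ⟪ν, matOp A ξ⟫_ℝ = c * ⟪ν, ξ⟫_ℝ := by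
  obtain ⟨-, c, hc⟩ := h
  refine ⟨c, fun ξ => ?_⟩
  rw [EuclideanSpace.inner_eq_star_dotProduct, EuclideanSpace.inner_eq_star_dotProduct,
    Matrix.ofLp_toEuclideanCLM, star_trivial, dotProduct_comm, Matrix.dotProduct_mulVec,
    dotProduct_comm (ξ.ofLp), ← smul_eq_mul, ← smul_dotProduct]
  congr 1

theorem abs_inner_matOp_sub_le {k : ℕ} {A A' : Matrix (Fin k) (Fin k) ℝ}
    {ν ξ : EuclideanSpace ℝ (Fin k)} {c : ℝ} (hν : ‖ν‖ = 1)
    (hc : ⟪ν, matOp A ξ⟫_ℝ = c * ⟪ν, ξ⟫_ℝ) :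
    |⟪ν, matOp A' ξ⟫_ℝ - c * ⟪ν, ξ⟫_ℝ| ≤ ‖matOp A' - matOp A‖ * ‖ξ‖ := by
  rw [← hc, ← inner_sub_right, ← sub_apply]
  refine (abs_real_inner_le_norm _ _).trans ?_
  rw [hν, one_mul]
  exact ContinuousLinearMap.le_opNorm _ _

theorem abs_le_norm_matOp {k : ℕ} {A : Matrix (Fin k) (Fin k) ℝ}
    {ν : EuclideanSpace ℝ (Fin k)} {c : ℝ} (hν : ‖ν‖ = 1)
    (hc : ⟪ν, matOp A ν⟫_ℝ = c * ⟪ν, ν⟫_ℝ) : |c| ≤ ‖matOp A‖ := by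
  rw [real_inner_self_eq_norm_sq, hν, one_pow, mul_one] at hc
  rw [← hc]
  refine (abs_real_inner_le_norm _ _).trans ?_
  simpa [hν] using (matOp A).le_opNorm ν

/-- `g` touches `w` from above at `p` (relative to `Ω`), and there it is a classical supersolution
of a linear equation with principal part `a`, whose other coefficients are bounded by `B`. -/
def TouchingSupersolution {n : ℕ} (Ω : Set (EuclideanSpace ℝ (Fin n) × ℝ))
    (a : Matrix (Fin n) (Fin n) ℝ) (c B : ℝ) (w g : EuclideanSpace ℝ (Fin n) × ℝ → ℝ)
    (p : EuclideanSpace ℝ (Fin n) × ℝ) : Prop :=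
  (∀ q ∈ Ω, w q ≤ g q) ∧ g p = w p ∧ ContDiffAt ℝ 2 (fun y => g (y, p.2)) p.1 ∧
    DifferentiableAt ℝ (fun s => g (p.1, s)) p.2 ∧
    ∃ (κ : ℝ) (μ : Fin n → ℝ), c ≤ κ ∧ κ ≤ B ∧ (∀ i, |μ i| ≤ B) ∧
      κ * (∑ i, ∑ j, a i j * fderiv ℝ (fderiv ℝ fun y => g (y, p.2)) p.1
          (EuclideanSpace.single j 1) (EuclideanSpace.single i 1))
        + (∑ i, μ i * fderiv ℝ (fun y => g (y, p.2)) p.1 (EuclideanSpace.single i 1)) - B * w p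
        ≤ deriv (fun s => g (p.1, s)) p.2

-- The touching function is g = ⟨ν, u − v⟩, with κ and μ the eigenvalues of D and the M_i at the
-- frontier point v. Compactness of C makes c and B independent of p, hence of the choice of v and
-- ν.
set_option maxHeartbeats 1000000 in
theorem exists_touchingSupersolution {n k : ℕ}
    {X : Set (EuclideanSpace ℝ (Fin n))}
    {a : EuclideanSpace ℝ (Fin n) × ℝ → Matrix (Fin n) (Fin n) ℝ}
    {D : EuclideanSpace ℝ (Fin n) × ℝ → EuclideanSpace ℝ (Fin k) →
      Matrix (Fin k) (Fin k) ℝ}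
    {M : Fin n → EuclideanSpace ℝ (Fin n) × ℝ → EuclideanSpace ℝ (Fin k) →
      Matrix (Fin k) (Fin k) ℝ}
    {φ : EuclideanSpace ℝ (Fin n) × ℝ → EuclideanSpace ℝ (Fin k) → EuclideanSpace ℝ (Fin k)}
    (hφL : LipschitzLocUnif (parabolicDomain X) φ)
    (hDL : LipschitzLocUnif (parabolicDomain X) (fun p z => matOp (D p z)))
    (hML : ∀ i, LipschitzLocUnif (parabolicDomain X) (fun p z => matOp (M i p z)))
    (haB : ∀ i j, LocBoundedOn (parabolicDomain X) (fun p => a p i j))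
    (hDB : LocBoundedOn (parabolicDomain X ×ˢ Set.univ) (fun q => matOp (D q.1 q.2)))
    (hMB : ∀ i, LocBoundedOn (parabolicDomain X ×ˢ Set.univ) (fun q => matOp (M i q.1 q.2)))
    (hDP : LocUnifPosDefOn
      (parabolicDomain X ×ˢ (Set.univ : Set (EuclideanSpace ℝ (Fin k))))
      (fun q => D q.1 q.2))
    {u : EuclideanSpace ℝ (Fin n) × ℝ → EuclideanSpace ℝ (Fin k)}
    (hu : IsC21On u (parabolicDomain X))
    (hueq : ∀ p ∈ parabolicDomain X,
      partialT u p = matOp (D p (u p)) (∑ i, ∑ j, a p i j • partialXX i j u p)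
        + ∑ i, matOp (M i p (u p)) (partialX i u p) + φ p (u p))
    {K : Set (EuclideanSpace ℝ (Fin k))} (hKcl : IsClosed K) (hKcv : Convex ℝ K)
    (hint : (interior K).Nonempty) (hne : (Kᶜ).Nonempty)
    (hK : IsCompatible (parabolicDomain X) K φ D M)
    (huK : ∀ p ∈ parabolicDomain X, u p ∈ K)
    {C : Set (EuclideanSpace ℝ (Fin n) × ℝ)} (hC : IsCompact C) (hCΩ : C ⊆ parabolicDomain X) :
    ∃ c B : ℝ, 0 < c ∧ 0 ≤ B ∧ ∀ p ∈ C, ∃ g,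
      TouchingSupersolution (parabolicDomain X) (a p) c B (fun q => Metric.infDist (u q) Kᶜ) g p := by
  obtain ⟨Lφ, hLφ⟩ := hφL C hCΩ hC
  obtain ⟨LD, hLD⟩ := hDL C hCΩ hC
  choose LM hLM using fun i => hML i C hCΩ hC
  choose A hA using fun i j => haB i j C hCΩ hC
  obtain ⟨R₁, hR₁⟩ := hC.exists_bound_of_continuousOn (hu.continuousOn.mono hCΩ)
  obtain ⟨R₂, hR₂⟩ := hC.exists_bound_of_continuousOn
    ((Metric.continuous_infDist_pt Kᶜ).comp_continuousOn (hu.continuousOn.mono hCΩ))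
  choose U₁ hU₁ using fun i => hC.exists_bound_of_continuousOn ((hu.continuousOn_x i).mono hCΩ)
  choose U₂ hU₂ using fun i j =>
    hC.exists_bound_of_continuousOn ((hu.continuousOn_xx i j).mono hCΩ)
  -- The nearest frontier point satisfies |v| ≤ |u(p)| + w(p) ≤ R₁ + R₂, so this one compact set
  -- serves for all bounds at v.
  have hQc : IsCompact (C ×ˢ Metric.closedBall (0 : EuclideanSpace ℝ (Fin k)) (R₁ + R₂)) :=
    hC.prod (isCompact_closedBall _ _)
  have hQ : C ×ˢ Metric.closedBall (0 : EuclideanSpace ℝ (Fin k)) (R₁ + R₂) ⊆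
      parabolicDomain X ×ˢ Set.univ := Set.prod_mono hCΩ (Set.subset_univ _)
  obtain ⟨BD, hBD⟩ := hDB _ hQ hQc
  choose BM hBM using fun i => hMB i _ hQ hQc
  obtain ⟨c, hc, hcD⟩ := hDP _ hQ hQc
  -- S₀ bounds the second-order sum on C, and B₀ collects the Lipschitz errors per unit of w. The
  -- absolute values matter only for empty C, where the bounds may be negative.
  set S₀ : ℝ := ∑ i, ∑ j, |A i j| * |U₂ i j| with hS₀
  have hS₀0 : 0 ≤ S₀ := by positivity
  set B₀ : ℝ := LD * S₀ + ∑ i, (LM i : ℝ) * |U₁ i| + Lφ with hB₀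
  have hB₀0 : 0 ≤ B₀ := by positivity
  refine ⟨c, B₀ + |BD| + ∑ i, |BM i|, hc, by positivity, fun p hp => ?_⟩
  have hpΩ := hCΩ hp
  obtain ⟨v, hv, hvd⟩ := exists_mem_frontier_dist_eq_infDist_compl hKcl hne (huK p hpΩ)
  obtain ⟨ν, hν, hνK⟩ := hKcv.exists_unit_inner_nonneg_of_mem_frontier hKcl hint hv
  obtain ⟨hφν, hDν, hMν⟩ := hK p hpΩ v hv ν (isInwardPointing_of_inner_nonneg hν hνK)
  obtain ⟨κ, hκ⟩ := hDν.exists_inner_matOp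
  choose μ hμ using fun i => (hMν i).exists_inner_matOp
  set w := Metric.infDist (u p) Kᶜ with hw
  have hw0 : 0 ≤ w := Metric.infDist_nonneg
  have hvQ : (p, v) ∈ C ×ˢ Metric.closedBall (0 : EuclideanSpace ℝ (Fin k)) (R₁ + R₂) := by
    refine ⟨hp, ?_⟩
    rw [mem_closedBall_zero_iff]
    have h1 : ‖v‖ ≤ ‖u p‖ + ‖u p - v‖ := by
      simpa using norm_sub_le (u p) (u p - v)
    have h2 := (le_abs_self _).trans (hR₂ p hp)
    have h3 := hR₁ p hp
    simp only [Function.comp_apply] at h2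
    linarith
  have hgt : HasDerivAt (fun s => ⟪ν, u (p.1, s) - v⟫_ℝ) ⟪ν, partialT u p⟫_ℝ p.2 :=
    (innerSL ℝ ν).hasFDerivAt.comp_hasDerivAt p.2
      ((hu.differentiableAt_t p hpΩ).hasDerivAt.sub_const v)
  have hux := hu.contDiffAt_x p hpΩ
  have hgx : ∀ᶠ y in nhds p.1, fderiv ℝ (fun y => ⟪ν, u (y, p.2) - v⟫_ℝ) y =
      (innerSL ℝ ν).comp (fderiv ℝ (fun y => u (y, p.2)) y) := by
    filter_upwards [hux.eventually (by simp)] with y hy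
    exact ((innerSL ℝ ν).hasFDerivAt.comp y
      ((hy.differentiableAt (by simp)).hasFDerivAt.sub_const v)).fderiv
  have hgx1 : ∀ i, fderiv ℝ (fun y => ⟪ν, u (y, p.2) - v⟫_ℝ) p.1 (EuclideanSpace.single i 1) =
      ⟪ν, partialX i u p⟫_ℝ := fun i => by
    rw [hgx.self_of_nhds]
    rfl
  have hgx2 : ∀ i j, fderiv ℝ (fderiv ℝ fun y => ⟪ν, u (y, p.2) - v⟫_ℝ) p.1
      (EuclideanSpace.single j 1) (EuclideanSpace.single i 1) = ⟪ν, partialXX i j u p⟫_ℝ := by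
    intro i j
    rw [Filter.EventuallyEq.fderiv_eq hgx, partialXX_eq hux]
    have h1 := (ContinuousLinearMap.compL ℝ (EuclideanSpace ℝ (Fin n)) (EuclideanSpace ℝ (Fin k)) ℝ
      (innerSL ℝ ν)).hasFDerivAt.comp p.1 hux.differentiableAt_fderiv.hasFDerivAt
    exact congrArg (fun T => T (EuclideanSpace.single j 1) (EuclideanSpace.single i 1)) h1.fderiv
  have hLip : ∀ {G : Type} [SeminormedAddCommGroup G]
      {f : EuclideanSpace ℝ (Fin k) → G} {L : ℝ≥0}, LipschitzWith L f →
      ‖f (u p) - f v‖ ≤ L * w := fun hf => by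
    have := hf.norm_sub_le (u p) v
    rwa [hvd] at this
  refine ⟨fun q => ⟪ν, u q - v⟫_ℝ, fun q hq => infDist_compl_le_inner hKcl hν hνK (huK q hq),
    le_antisymm ?_ (infDist_compl_le_inner hKcl hν hνK (huK p hpΩ)),
    (contDiffAt_const.inner ℝ (hux.sub contDiffAt_const)), hgt.differentiableAt, κ, μ, ?_, ?_,
    fun i => ?_, ?_⟩
  · refine (real_inner_le_norm _ _).trans ?_
    rw [hν, one_mul, hvd]
  -- Testing positivity of D(p, v) on ν itself bounds its eigenvalue below.
  · have := hcD _ hvQ ν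
    simpa [hκ, hν] using this
  · have h1 := (le_abs_self _).trans (abs_le_norm_matOp hν (hκ ν))
    have h2 := (hBD _ hvQ).trans (le_abs_self _)
    have h3 : 0 ≤ ∑ i, |BM i| := by positivity
    simp only at h2
    linarith
  · have h1 := abs_le_norm_matOp hν (hμ i ν)
    have h2 := (hBM i _ hvQ).trans (le_abs_self _)
    have h3 : |BM i| ≤ ∑ i, |BM i| :=
      Finset.single_le_sum (f := fun i => |BM i|) (fun _ _ => abs_nonneg _) (Finset.mem_univ i)
    have h4 := abs_nonneg BD
    simp only at h2
    linarith
  · rw [hgt.deriv]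
    simp only [hgx1, hgx2]
    set s := ∑ i, ∑ j, a p i j • partialXX i j u p with hs
    have hsν : ∑ i, ∑ j, a p i j * ⟪ν, partialXX i j u p⟫_ℝ = ⟪ν, s⟫_ℝ := by
      simp [hs, inner_sum, real_inner_smul_right]
    have hsn : ‖s‖ ≤ S₀ := by
      refine (norm_sum_le _ _).trans (Finset.sum_le_sum fun i _ => ?_)
      refine (norm_sum_le _ _).trans (Finset.sum_le_sum fun j _ => ?_)
      rw [norm_smul]
      exact mul_le_mul ((hA i j p hp).trans (le_abs_self _)) ((hU₂ i j p hp).trans (le_abs_self _))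
        (norm_nonneg _) (abs_nonneg _)
    -- The eigenvector relations and the sign of φ hold only at v; `e1`, `e2`, `e3` pay for passing
    -- to u(p) with multiples of w.
    have e1 : κ * ⟪ν, s⟫_ℝ - LD * S₀ * w ≤ ⟪ν, matOp (D p (u p)) s⟫_ℝ := by
      have h1 := neg_le_of_abs_le (abs_inner_matOp_sub_le (A' := D p (u p)) hν (hκ s))
      have h2 : ‖matOp (D p (u p)) - matOp (D p v)‖ * ‖s‖ ≤ (LD * w) * S₀ :=
        mul_le_mul (hLip (hLD p hp)) hsn (norm_nonneg _) (by positivity)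
      linarith
    have e2 : ∀ i, μ i * ⟪ν, partialX i u p⟫_ℝ - LM i * |U₁ i| * w ≤
        ⟪ν, matOp (M i p (u p)) (partialX i u p)⟫_ℝ := fun i => by
      have h1 := neg_le_of_abs_le
        (abs_inner_matOp_sub_le (A' := M i p (u p)) hν (hμ i (partialX i u p)))
      have h2 : ‖matOp (M i p (u p)) - matOp (M i p v)‖ * ‖partialX i u p‖ ≤
          (LM i * w) * |U₁ i| :=
        mul_le_mul (hLip (hLM i p hp)) ((hU₁ i p hp).trans (le_abs_self _)) (norm_nonneg _)
          (by positivity)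
      linarith
    have e2' := Finset.sum_le_sum fun i (_ : i ∈ Finset.univ) => e2 i
    rw [Finset.sum_sub_distrib, ← Finset.sum_mul] at e2'
    have e3 : -(Lφ * w) ≤ ⟪ν, φ p (u p)⟫_ℝ := by
      have h1 : |⟪ν, φ p (u p) - φ p v⟫_ℝ| ≤ Lφ * w := by
        refine (abs_real_inner_le_norm _ _).trans ?_
        rw [hν, one_mul]
        exact hLip (hLφ p hp)
      have h2 := neg_le_of_abs_le h1
      rw [inner_sub_right] at h2
      rw [real_inner_comm] at hφν
      linarith
    -- The surplus of B over B₀ is there to bound κ and μ; in the zero-order term it only helps, as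
    -- w ≥ 0.
    have e4 : 0 ≤ (|BD| + ∑ i, |BM i|) * w := by positivity
    rw [hueq p hpΩ, inner_add_right, inner_add_right, inner_sum, hsν]
    rw [hB₀]
    linarith

/-! ### The barrier and the propagation of positivity. -/

section BarrierDerivatives

variable {E : Type*} [NormedAddCommGroup E] [InnerProductSpace ℝ E]

theorem norm_add_smul_sub_sq (x z b : E) (r : ℝ) :
    ‖x + r • b - z‖ ^ 2 = ‖x - z‖ ^ 2 + 2 * r * ⟪x - z, b⟫_ℝ + r ^ 2 * ‖b‖ ^ 2 := by
  rw [add_sub_right_comm, norm_add_sq_real, real_inner_smul_right, norm_smul, mul_pow,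
    Real.norm_eq_abs, sq_abs]
  ring

theorem hasDerivAt_sq_quadratic (S β γ r : ℝ) :
    HasDerivAt (fun r : ℝ => (S - 2 * r * β - r ^ 2 * γ) ^ 2)
      (2 * (S - 2 * r * β - r ^ 2 * γ) * (-2 * β - 2 * r * γ)) r := by
  have h1 : HasDerivAt (fun r : ℝ => S - 2 * r * β - r ^ 2 * γ) (-2 * β - 2 * r * γ) r := by
    have := ((((hasDerivAt_id r).const_mul 2).mul_const β).const_sub S).sub
      (((hasDerivAt_id r).pow 2).mul_const γ)
    refine this.congr_deriv ?_
    simp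
  refine (h1.pow 2).congr_deriv ?_
  simp

theorem hasDerivAt_deriv_sq_quadratic (S β γ : ℝ) :
    HasDerivAt (fun r : ℝ => 2 * (S - 2 * r * β - r ^ 2 * γ) * (-2 * β - 2 * r * γ))
      (8 * β ^ 2 - 4 * S * γ) 0 := by
  have h1 : HasDerivAt (fun r : ℝ => S - 2 * r * β - r ^ 2 * γ) (-2 * β) 0 := by
    have := ((((hasDerivAt_id (0 : ℝ)).const_mul 2).mul_const β).const_sub S).sub
      (((hasDerivAt_id (0 : ℝ)).pow 2).mul_const γ)
    refine this.congr_deriv ?_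
    simp
  have h2 : HasDerivAt (fun r : ℝ => -2 * β - 2 * r * γ) (-2 * γ) 0 := by
    have := (((hasDerivAt_id (0 : ℝ)).const_mul 2).mul_const γ).const_sub (-2 * β)
    refine this.congr_deriv ?_
    simp
  refine ((h1.const_mul 2).mul h2).congr_deriv ?_
  simp
  ring

variable {G : E → ℝ} {x z : E} {e R : ℝ}

/-- On the line through x in direction b the barrier is e times the square of a quadratic
polynomial, and the first and second derivative tests apply at parameter 0. -/
theorem fderiv_and_second_deriv_of_touching_barrier (hG : ContDiffAt ℝ 2 G x)
    (hmin : IsLocalMin (fun y => G y - e * (R - ‖y - z‖ ^ 2) ^ 2) x) (b : E) :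
    fderiv ℝ G x b = -(4 * e * (R - ‖x - z‖ ^ 2) * ⟪x - z, b⟫_ℝ) ∧
      e * (8 * ⟪x - z, b⟫_ℝ ^ 2 - 4 * (R - ‖x - z‖ ^ 2) * ‖b‖ ^ 2) ≤
        fderiv ℝ (fderiv ℝ G) x b b := by
  set S := R - ‖x - z‖ ^ 2 with hS
  set β := ⟪x - z, b⟫_ℝ with hβ
  set γ := ‖b‖ ^ 2 with hγ
  have hline : ∀ r : ℝ, R - ‖x + r • b - z‖ ^ 2 = S - 2 * r * β - r ^ 2 * γ := fun r => by
    rw [norm_add_smul_sub_sq]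
    ring
  have hmin' : IsLocalMin (fun r : ℝ => G (x + r • b) - e * (S - 2 * r * β - r ^ 2 * γ) ^ 2) 0 := by
    have hc : Filter.Tendsto (fun r : ℝ => x + r • b) (nhds 0) (nhds x) := by
      have : Continuous fun r : ℝ => x + r • b := by fun_prop
      simpa using this.tendsto 0
    have := hc.eventually hmin
    filter_upwards [this] with r hr
    rw [← hline, ← hline]
    simpa using hr
  have hd1 : ∀ᶠ r : ℝ in nhds 0, HasDerivAt
      (fun r : ℝ => G (x + r • b) - e * (S - 2 * r * β - r ^ 2 * γ) ^ 2)
      (fderiv ℝ G (x + r • b) b - e * (2 * (S - 2 * r * β - r ^ 2 * γ) * (-2 * β - 2 * r * γ))) r :=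
    (hG.eventually_hasDerivAt_line b).mono fun r hr =>
      hr.sub ((hasDerivAt_sq_quadratic S β γ r).const_mul e)
  have hd2 := (hG.hasDerivAt_fderiv_line b).sub ((hasDerivAt_deriv_sq_quadratic S β γ).const_mul e)
  constructor
  · have := hmin'.hasDerivAt_eq_zero hd1.self_of_nhds
    simp at this
    linarith
  · linarith [hmin'.second_deriv_nonneg hd1 hd2]

end BarrierDerivatives

/-- With A = BᵀB, the directional tests are summed over the rows b_l of B, using Σ ⟨y, b_l⟩² = ⟨y,
Ay⟩ and Σ |b_l|² = tr A. -/
theorem trace_second_deriv_of_touching_barrier {n : ℕ} {A : Matrix (Fin n) (Fin n) ℝ}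
    (hs : A.IsSymm) (hp : ∀ ξ : EuclideanSpace ℝ (Fin n), 0 ≤ ⟪ξ, matOp A ξ⟫_ℝ)
    {G : EuclideanSpace ℝ (Fin n) → ℝ} {x z : EuclideanSpace ℝ (Fin n)} {e R : ℝ}
    (hG : ContDiffAt ℝ 2 G x)
    (hmin : IsLocalMin (fun y => G y - e * (R - ‖y - z‖ ^ 2) ^ 2) x) :
    e * (8 * ⟪x - z, matOp A (x - z)⟫_ℝ - 4 * (R - ‖x - z‖ ^ 2) * A.trace) ≤
      ∑ i, ∑ j, A i j * fderiv ℝ (fderiv ℝ G) x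
        (EuclideanSpace.single j 1) (EuclideanSpace.single i 1) := by
  obtain ⟨B, hB⟩ := Matrix.exists_transpose_mul_self hs hp
  set H := fderiv ℝ (fderiv ℝ G) x with hH
  set y := x - z with hy
  let b : Fin n → EuclideanSpace ℝ (Fin n) := fun l => WithLp.toLp 2 (B l)
  have hb : ∀ l, b l = ∑ i, B l i • EuclideanSpace.single i (1 : ℝ) := fun l => by
    ext j
    simp [b, Pi.single_apply]
  have hHb : ∀ l, H (b l) (b l) = ∑ i, ∑ j, B l i * B l j *
      H (EuclideanSpace.single j 1) (EuclideanSpace.single i 1) := fun l => by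
    rw [hb]
    simp only [map_sum, map_smul, sum_apply, smul_apply,
      smul_eq_mul, Finset.mul_sum]
    exact Finset.sum_congr rfl fun i _ => Finset.sum_congr rfl fun j _ => by ring
  have hsum := Finset.sum_le_sum fun l (_ : l ∈ Finset.univ) =>
    (fderiv_and_second_deriv_of_touching_barrier hG hmin (b l)).2
  have e1 : ∑ l, H (b l) (b l) = ∑ i, ∑ j, A i j *
      H (EuclideanSpace.single j 1) (EuclideanSpace.single i 1) := by
    simp only [hHb, hB, Finset.sum_mul]
    rw [Finset.sum_comm]
    exact Finset.sum_congr rfl fun i _ => Finset.sum_comm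
  have e2 : ∑ l, ⟪y, b l⟫_ℝ ^ 2 = ⟪y, matOp A y⟫_ℝ := by
    have h1 : ∀ l, ⟪y, b l⟫_ℝ = ∑ i, B l i * y i := fun l => by
      simp [b, PiLp.inner_apply]
    have h2 : ⟪y, matOp A y⟫_ℝ = ∑ i, ∑ j, ∑ l, B l i * B l j * y i * y j := by
      simp only [PiLp.inner_apply, Matrix.ofLp_toEuclideanCLM, Matrix.mulVec, dotProduct, hB]
      simp only [RCLike.inner_apply, conj_trivial, Finset.sum_mul]
      exact Finset.sum_congr rfl fun i _ => Finset.sum_congr rfl fun j _ =>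
        Finset.sum_congr rfl fun l _ => by ring
    rw [h2]
    simp only [h1, sq, Finset.sum_mul_sum]
    rw [Finset.sum_comm]
    refine Finset.sum_congr rfl fun i _ => ?_
    rw [Finset.sum_comm]
    exact Finset.sum_congr rfl fun j _ => Finset.sum_congr rfl fun l _ => by ring
  have e3 : ∑ l, ‖b l‖ ^ 2 = A.trace := by
    simp only [EuclideanSpace.norm_sq_eq, Matrix.trace, Matrix.diag, hB, b, Real.norm_eq_abs,
      sq_abs]
    rw [Finset.sum_comm]
    exact Finset.sum_congr rfl fun j _ => Finset.sum_congr rfl fun l _ => by ring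
  rw [e1] at hsum
  refine le_trans (le_of_eq ?_) hsum
  rw [← Finset.mul_sum, Finset.sum_sub_distrib, ← Finset.mul_sum, ← Finset.mul_sum, e2, e3]

theorem hasDerivAt_barrier_time {E : Type*} [NormedAddCommGroup E] [InnerProductSpace ℝ E]
    (x x₁ V : E) (ε α R t₁ t : ℝ) :
    HasDerivAt (fun s : ℝ => ε * Real.exp (-α * (s - t₁)) *
        (R - ‖x - (x₁ + (s - t₁) • V)‖ ^ 2) ^ 2)
      (ε * Real.exp (-α * (t - t₁)) * (-α * (R - ‖x - (x₁ + (t - t₁) • V)‖ ^ 2) ^ 2 +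
        4 * (R - ‖x - (x₁ + (t - t₁) • V)‖ ^ 2) * ⟪x - (x₁ + (t - t₁) • V), V⟫_ℝ)) t := by
  have h0 : HasDerivAt (fun s : ℝ => s - t₁) 1 t := (hasDerivAt_id t).sub_const t₁
  have h1 : HasDerivAt (fun s : ℝ => x - (x₁ + (s - t₁) • V)) (-V) t := by
    simpa using ((h0.smul_const V).const_add x₁).const_sub x
  have h2 := ((h1.norm_sq.const_sub R).pow 2)
  have h3 := ((h0.const_mul (-α)).exp.const_mul ε).mul h2
  refine h3.congr_deriv ?_
  simp [inner_neg_right]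
  ring

/-- The inequality which makes the barrier a strict subsolution for `α` large. -/
theorem barrier_coefficient_pos {q κ c₁ C α S : ℝ} (hq : 0 < q) (hκ : 0 < κ)
    (hα : C + (8 * κ + c₁) ^ 2 / (8 * κ * q) < α) :
    0 < 8 * κ * (q - S) - c₁ * S + (α - C) * S ^ 2 := by
  have hP : 0 < 8 * κ * q := by positivity
  set Q := 8 * κ + c₁ with hQ
  have h1 : Q ^ 2 / (8 * κ * q) ≤ α - C := by linarith
  have h2 : Q ^ 2 / (8 * κ * q) * S ^ 2 ≤ (α - C) * S ^ 2 :=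
    mul_le_mul_of_nonneg_right h1 (sq_nonneg S)
  -- With s = QS / (8κq) this is 8κq(1 − s + s²), a positive quantity; the threshold for α is chosen
  -- to produce exactly the s² term.
  have h3 : 8 * κ * q - Q * S + Q ^ 2 / (8 * κ * q) * S ^ 2 =
      8 * κ * q * ((1 - Q * S / (8 * κ * q) / 2) ^ 2 + 3 / 4 * (Q * S / (8 * κ * q)) ^ 2) := by
    field_simp
    ring
  have h4 : 0 < (1 - Q * S / (8 * κ * q) / 2) ^ 2 + 3 / 4 * (Q * S / (8 * κ * q)) ^ 2 := by
    nlinarith [sq_nonneg (1 - Q * S / (8 * κ * q)), sq_nonneg (Q * S / (8 * κ * q))]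
  have h5 := mul_pos hP h4
  rw [← h3] at h5
  have h6 : 8 * κ * (q - S) - c₁ * S = 8 * κ * q - Q * S := by rw [hQ]; ring
  linarith

/-- A minimum of w minus the barrier is also one of g minus the barrier, so the derivative tests
bound the derivatives of g by those of the barrier. Inserted in the inequality for g, they
contradict the barrier being a strict subsolution. In `hα`, the three terms 4BA₀, 4nBρ and 4ρ‖V‖
come from the trace, the drift and the motion of the centre. -/
theorem not_touchingSupersolution_of_barrier {n : ℕ}
    {Ω T : Set (EuclideanSpace ℝ (Fin n) × ℝ)} {A : Matrix (Fin n) (Fin n) ℝ} {c B θ A₀ : ℝ}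
    {w g : EuclideanSpace ℝ (Fin n) × ℝ → ℝ} {x x₁ V : EuclideanSpace ℝ (Fin n)}
    {t t₁ t₂ ε α ρ : ℝ} (hc : 0 < c) (hB : 0 ≤ B) (hθ : 0 < θ) (hρ : 0 < ρ) (hε : 0 < ε)
    (hs : A.IsSymm) (hA : ∀ ξ : EuclideanSpace ℝ (Fin n), θ * ‖ξ‖ ^ 2 ≤ ⟪ξ, matOp A ξ⟫_ℝ)
    (htr : |A.trace| ≤ A₀)
    (hα : B + (8 * (c * θ) + (4 * B * A₀ + 4 * (n * B * ρ) + 4 * (ρ * ‖V‖))) ^ 2 /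
      (8 * (c * θ) * ρ ^ 2) < α)
    (hT : ∀ q, q ∈ T ↔ ‖q.1 - (x₁ + (q.2 - t₁) • V)‖ ≤ ρ ∧ t₁ ≤ q.2 ∧ q.2 ≤ t₂) (hTΩ : T ⊆ Ω)
    (ht : t₁ < t) (ht₂ : t ≤ t₂) (hx : ‖x - (x₁ + (t - t₁) • V)‖ < ρ)
    (hmin : ∀ q ∈ T, w (x, t) - ε * Real.exp (-α * (t - t₁)) *
        (ρ ^ 2 - ‖x - (x₁ + (t - t₁) • V)‖ ^ 2) ^ 2 ≤
      w q - ε * Real.exp (-α * (q.2 - t₁)) * (ρ ^ 2 - ‖q.1 - (x₁ + (q.2 - t₁) • V)‖ ^ 2) ^ 2)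
    (hneg : w (x, t) < ε * Real.exp (-α * (t - t₁)) *
        (ρ ^ 2 - ‖x - (x₁ + (t - t₁) • V)‖ ^ 2) ^ 2) :
    ¬ TouchingSupersolution Ω A c B w g (x, t) := by
  rintro ⟨hwg, hgw, hgx, hgt, κ, μ, hκc, hκB, hμ, hineq⟩
  simp only at hgx hgt hineq
  set e := ε * Real.exp (-α * (t - t₁)) with he
  have he0 : 0 < e := by positivity
  set z := x₁ + (t - t₁) • V with hz
  set y := x - z with hy
  set S := ρ ^ 2 - ‖y‖ ^ 2 with hS
  have hS0 : 0 < S := by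
    have := norm_nonneg y
    rw [hS, sub_pos]
    gcongr
  have hspace : IsLocalMin (fun y => g (y, t) - e * (ρ ^ 2 - ‖y - z‖ ^ 2) ^ 2) x := by
    have hn : ∀ᶠ y in nhds x, ‖y - z‖ < ρ :=
      (show Continuous fun y => ‖y - z‖ by fun_prop).continuousAt.eventually_lt
        continuousAt_const hx
    filter_upwards [hn] with y' hy'
    have hmem : (y', t) ∈ T := (hT _).2 ⟨hy'.le, ht.le, ht₂⟩
    rw [hgw]
    exact (hmin _ hmem).trans (sub_le_sub_right (hwg _ (hTΩ hmem)) _)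
  have htime : ∀ᶠ s in nhdsWithin t (Set.Iio t),
      g (x, t) - e * (ρ ^ 2 - ‖x - z‖ ^ 2) ^ 2 ≤ g (x, s) - ε * Real.exp (-α * (s - t₁)) *
        (ρ ^ 2 - ‖x - (x₁ + (s - t₁) • V)‖ ^ 2) ^ 2 := by
    have hn : ∀ᶠ s in nhds t, ‖x - (x₁ + (s - t₁) • V)‖ < ρ :=
      (show Continuous fun s : ℝ => ‖x - (x₁ + (s - t₁) • V)‖ by
        fun_prop).continuousAt.eventually_lt continuousAt_const hx
    filter_upwards [nhdsWithin_le_nhds hn, nhdsWithin_le_nhds (lt_mem_nhds ht),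
      self_mem_nhdsWithin] with s hs1 hs2 hs3
    have hmem : (x, s) ∈ T := (hT _).2 ⟨hs1.le, le_of_lt hs2, (le_of_lt hs3).trans ht₂⟩
    rw [hgw]
    exact (hmin _ hmem).trans (sub_le_sub_right (hwg _ (hTΩ hmem)) _)
  have h1 := (hgt.hasDerivAt.sub
    (hasDerivAt_barrier_time x x₁ V ε α (ρ ^ 2) t₁ t)).nonpos_of_eventually_le_left htime
  rw [← he, ← hz, ← hy, ← hS] at h1
  have h2 : ∀ i, fderiv ℝ (fun y => g (y, t)) x (EuclideanSpace.single i 1) =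
      -(4 * e * S * y i) := fun i => by
    rw [(fderiv_and_second_deriv_of_touching_barrier hgx hspace _).1]
    simp [EuclideanSpace.inner_single_right, hy, hS]
  have h3 := trace_second_deriv_of_touching_barrier hs
    (fun ξ => (by positivity : 0 ≤ θ * ‖ξ‖ ^ 2).trans (hA ξ)) hgx hspace
  rw [← hy, ← hS] at h3
  simp only [h2] at hineq
  set H := ∑ i, ∑ j, A i j * fderiv ℝ (fderiv ℝ fun y => g (y, t)) x
    (EuclideanSpace.single j 1) (EuclideanSpace.single i 1) with hH
  set N := ∑ i, μ i * y i with hN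
  have hyρ : ‖y‖ ≤ ρ := hx.le
  have hNle : N ≤ n * B * ρ := by
    have : ∀ i ∈ Finset.univ, μ i * y i ≤ B * ρ := fun i _ => by
      refine (le_abs_self _).trans ?_
      rw [abs_mul]
      exact mul_le_mul (hμ i) ((PiLp.norm_apply_le y i).trans hyρ) (abs_nonneg _) hB
    refine (Finset.sum_le_sum this).trans (le_of_eq ?_)
    simp [mul_assoc]
  have hNsum : ∑ i, μ i * -(4 * e * S * y i) = -(4 * e * S * N) := by
    rw [hN, Finset.mul_sum, ← Finset.sum_neg_distrib]
    exact Finset.sum_congr rfl fun i _ => by ring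
  rw [hNsum] at hineq
  have hyV : ⟪y, V⟫_ℝ ≤ ρ * ‖V‖ :=
    (real_inner_le_norm _ _).trans (mul_le_mul_of_nonneg_right hyρ (norm_nonneg _))
  have hκ0 : 0 < κ := hc.trans_le hκc
  have h4 : e * (8 * (c * θ) * ‖y‖ ^ 2 - 4 * S * (B * A₀)) ≤ κ * H := by
    have h5 := mul_le_mul_of_nonneg_left h3 hκ0.le
    have h6 : c * (θ * ‖y‖ ^ 2) ≤ κ * ⟪y, matOp A y⟫_ℝ :=
      mul_le_mul hκc (hA y) (by positivity) hκ0.le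
    have h7 : κ * A.trace ≤ B * A₀ :=
      (mul_le_mul_of_nonneg_left ((le_abs_self _).trans htr) hκ0.le).trans
        (mul_le_mul_of_nonneg_right hκB ((abs_nonneg _).trans htr))
    have h8 := mul_le_mul_of_nonneg_left h7 hS0.le
    have h9 : 8 * (c * θ) * ‖y‖ ^ 2 - 4 * S * (B * A₀) ≤
        κ * (8 * ⟪y, matOp A y⟫_ℝ - 4 * S * A.trace) := by linarith
    have h10 := mul_le_mul_of_nonneg_left h9 he0.le
    linarith
  -- Negativity of the minimum is what controls the zero-order term: w is below the barrier there.
  have h5 : B * w (x, t) ≤ B * (e * S ^ 2) := mul_le_mul_of_nonneg_left hneg.le hB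
  have h6 := mul_le_mul_of_nonneg_left hNle (mul_nonneg he0.le hS0.le)
  have h7 := mul_le_mul_of_nonneg_left hyV (mul_nonneg he0.le hS0.le)
  have hpos := mul_pos he0 (barrier_coefficient_pos (S := S) (by positivity : 0 < ρ ^ 2)
    (mul_pos hc hθ) hα)
  have hyS : ρ ^ 2 - S = ‖y‖ ^ 2 := by rw [hS]; ring
  rw [hyS] at hpos
  linarith

/-- The tube T has a centre moving from x₁ to x₂ with velocity V. The barrier vanishes on its
lateral boundary and lies below w at time t₁, so w minus the barrier could be negative only at a
minimum excluded by `not_touchingSupersolution_of_barrier`. At (x₂, t₂), on the axis, the barrier is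
positive. -/
theorem pos_of_segment_subset {n : ℕ} {X : Set (EuclideanSpace ℝ (Fin n))} (hXo : IsOpen X)
    {a : EuclideanSpace ℝ (Fin n) × ℝ → Matrix (Fin n) (Fin n) ℝ}
    (haB : ∀ i j, LocBoundedOn (parabolicDomain X) (fun p => a p i j))
    (haS : ∀ p ∈ parabolicDomain X, (a p).IsSymm)
    (haP : LocUnifPosDefOn (parabolicDomain X) a)
    {w : EuclideanSpace ℝ (Fin n) × ℝ → ℝ} (hwc : ContinuousOn w (parabolicDomain X))
    (hw0 : ∀ p, 0 ≤ w p)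
    (hw : ∀ C : Set (EuclideanSpace ℝ (Fin n) × ℝ), IsCompact C → C ⊆ parabolicDomain X →
      ∃ c B : ℝ, 0 < c ∧ 0 ≤ B ∧ ∀ p ∈ C, ∃ g,
        TouchingSupersolution (parabolicDomain X) (a p) c B w g p)
    {x₁ x₂ : EuclideanSpace ℝ (Fin n)} {t₁ t₂ : ℝ} (hseg : segment ℝ x₁ x₂ ⊆ X) (ht₁ : 0 < t₁)
    (ht : t₁ < t₂) (hpos : 0 < w (x₁, t₁)) : 0 < w (x₂, t₂) := by
  have hτ : 0 < t₂ - t₁ := sub_pos.2 ht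
  have hsegc : IsCompact (segment ℝ x₁ x₂) := by
    rw [segment_eq_image_lineMap]
    exact isCompact_Icc.image (AffineMap.lineMap_continuous)
  obtain ⟨δ₁, hδ₁, hδX⟩ := hsegc.exists_cthickening_subset_open hXo hseg
  have hx₁ : x₁ ∈ X := hseg (left_mem_segment ℝ _ _)
  have hwx : ContinuousAt (fun y => w (y, t₁)) x₁ := by
    have h1 : ContinuousAt w (x₁, t₁) := hwc.continuousAt
      ((hXo.prod isOpen_Ioi).mem_nhds ⟨hx₁, ht₁⟩)
    exact ContinuousAt.comp (f := fun y => (y, t₁)) (g := w) h1 (by fun_prop)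
  obtain ⟨δ₂, hδ₂, hδw⟩ := Metric.nhds_basis_closedBall.eventually_iff.1
    (hwx.eventually (lt_mem_nhds (half_lt_self hpos)))
  -- δ₁ keeps the tube inside X; δ₂ keeps w(·, t₁) above half its value at x₁ on the bottom of the
  -- tube.
  set ρ := min δ₁ δ₂ with hρ
  have hρ0 : 0 < ρ := lt_min hδ₁ hδ₂
  set V := (t₂ - t₁)⁻¹ • (x₂ - x₁) with hV
  have hcenter : ∀ s, t₁ ≤ s → s ≤ t₂ → x₁ + (s - t₁) • V ∈ segment ℝ x₁ x₂ := by
    intro s hs1 hs2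
    rw [segment_eq_image']
    refine ⟨(s - t₁) / (t₂ - t₁), ⟨div_nonneg (by linarith) hτ.le,
      (div_le_one hτ).2 (by linarith)⟩, ?_⟩
    simp only [hV, smul_smul, div_eq_mul_inv]
  set T : Set (EuclideanSpace ℝ (Fin n) × ℝ) :=
    {q | ‖q.1 - (x₁ + (q.2 - t₁) • V)‖ ≤ ρ ∧ t₁ ≤ q.2 ∧ q.2 ≤ t₂} with hTdef
  have hT : ∀ q, q ∈ T ↔ ‖q.1 - (x₁ + (q.2 - t₁) • V)‖ ≤ ρ ∧ t₁ ≤ q.2 ∧ q.2 ≤ t₂ :=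
    fun q => Iff.rfl
  have hTΩ : T ⊆ parabolicDomain X := by
    rintro q ⟨h1, h2, h3⟩
    refine ⟨hδX (Metric.closedBall_subset_cthickening (hcenter _ h2 h3) δ₁ ?_), ht₁.trans_le h2⟩
    rw [Metric.mem_closedBall, dist_eq_norm]
    exact h1.trans (min_le_left _ _)
  have hTc : IsCompact T := by
    have h1 : IsCompact ((fun q : EuclideanSpace ℝ (Fin n) × ℝ =>
        (q.1 + (x₁ + (q.2 - t₁) • V), q.2)) '' (Metric.closedBall 0 ρ ×ˢ Set.Icc t₁ t₂)) :=
      ((isCompact_closedBall _ _).prod isCompact_Icc).image (by fun_prop)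
    convert h1 using 1
    ext q
    constructor
    · rintro ⟨h1, h2, h3⟩
      exact ⟨(q.1 - (x₁ + (q.2 - t₁) • V), q.2), ⟨mem_closedBall_zero_iff.2 h1, h2, h3⟩, by simp⟩
    · rintro ⟨r, ⟨h1, h2, h3⟩, rfl⟩
      exact ⟨by simpa using h1, h2, h3⟩
  obtain ⟨c, B, hc, hB, htouch⟩ := hw T hTc hTΩ
  obtain ⟨θ, hθ, hA⟩ := haP T hTΩ hTc
  choose A hAb using fun i => haB i i T hTΩ hTc
  set A₀ := ∑ i, A i with hA₀
  obtain ⟨α, hα⟩ := exists_gt (B + (8 * (c * θ) + (4 * B * A₀ + 4 * (n * B * ρ) +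
    4 * (ρ * ‖V‖))) ^ 2 / (8 * (c * θ) * ρ ^ 2))
  -- At time t₁ the barrier is at most ερ⁴ = w(x₁, t₁)/2.
  set ε := w (x₁, t₁) / 2 / ρ ^ 4 with hε
  have hε0 : 0 < ε := by positivity
  let f : EuclideanSpace ℝ (Fin n) × ℝ → ℝ := fun q =>
    w q - ε * Real.exp (-α * (q.2 - t₁)) * (ρ ^ 2 - ‖q.1 - (x₁ + (q.2 - t₁) • V)‖ ^ 2) ^ 2
  have hfc : ContinuousOn f T := (hwc.mono hTΩ).sub (by fun_prop)
  have hx₂ : x₁ + (t₂ - t₁) • V = x₂ := by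
    rw [hV, smul_smul, mul_inv_cancel₀ hτ.ne', one_smul, add_sub_cancel]
  have hmem₂ : (x₂, t₂) ∈ T := by
    refine ⟨?_, ht.le, le_rfl⟩
    simp only [hx₂, sub_self, norm_zero]
    exact hρ0.le
  obtain ⟨⟨x, t⟩, hxt, hmin⟩ := hTc.exists_isMinOn ⟨_, hmem₂⟩ hfc
  have hf0 : 0 ≤ f (x, t) := by
    by_contra! hlt
    obtain ⟨hxρ, ht1, ht2⟩ := id hxt
    simp only at hxρ ht1 ht2
    have hneg : w (x, t) < ε * Real.exp (-α * (t - t₁)) *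
        (ρ ^ 2 - ‖x - (x₁ + (t - t₁) • V)‖ ^ 2) ^ 2 := sub_neg.1 hlt
    have hxlt : ‖x - (x₁ + (t - t₁) • V)‖ < ρ := by
      refine hxρ.lt_of_ne fun heq => ?_
      rw [heq] at hneg
      simp only [sub_self, ne_eq, OfNat.ofNat_ne_zero, not_false_eq_true, zero_pow, mul_zero]
        at hneg
      exact hneg.not_ge (hw0 _)
    have htlt : t₁ < t := by
      refine ht1.lt_of_ne fun heq => ?_
      subst heq
      simp only [sub_self, zero_smul, add_zero, mul_zero, Real.exp_zero, mul_one] at hneg hxρ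
      have h1 : w (x₁, t₁) / 2 < w (x, t₁) := hδw (by
        rw [Metric.mem_closedBall, dist_eq_norm]
        exact hxρ.trans (min_le_right _ _))
      have h2 : (ρ ^ 2 - ‖x - x₁‖ ^ 2) ^ 2 ≤ ρ ^ 4 := by
        have h3 : ‖x - x₁‖ ^ 2 ≤ ρ ^ 2 := pow_le_pow_left₀ (norm_nonneg _) hxρ 2
        calc (ρ ^ 2 - ‖x - x₁‖ ^ 2) ^ 2 ≤ (ρ ^ 2) ^ 2 :=
              pow_le_pow_left₀ (sub_nonneg.2 h3) (sub_le_self _ (sq_nonneg _)) 2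
          _ = ρ ^ 4 := by ring
      have h3 : ε * ρ ^ 4 = w (x₁, t₁) / 2 := by
        rw [hε]
        field_simp
      have h4 := mul_le_mul_of_nonneg_left h2 hε0.le
      linarith
    obtain ⟨g, hg⟩ := htouch _ hxt
    refine not_touchingSupersolution_of_barrier hc hB hθ hρ0 hε0 (haS _ (hTΩ hxt)) (hA _ hxt) ?_ hα
      hT hTΩ htlt ht2 hxlt (fun q hq => hmin hq) hneg hg
    exact (Finset.abs_sum_le_sum_abs _ _).trans (Finset.sum_le_sum fun i _ => hAb i _ hxt)
  have h2 : 0 ≤ f (x₂, t₂) := hf0.trans (hmin hmem₂)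
  simp only [f, hx₂, sub_self, norm_zero, ne_eq, OfNat.ofNat_ne_zero, not_false_eq_true, zero_pow,
    sub_zero, sub_nonneg] at h2
  exact lt_of_lt_of_le (by positivity) h2

/-- The relation P allows every pair of times s < t, which makes it transitive through an
intermediate time. It holds both ways between a point and its neighbours, since small balls are
convex, and a preconnected set then relates all its points. -/
theorem pos_of_isPreconnected {n : ℕ} {X : Set (EuclideanSpace ℝ (Fin n))} (hXo : IsOpen X)
    (hXc : IsPreconnected X)
    {a : EuclideanSpace ℝ (Fin n) × ℝ → Matrix (Fin n) (Fin n) ℝ}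
    (haB : ∀ i j, LocBoundedOn (parabolicDomain X) (fun p => a p i j))
    (haS : ∀ p ∈ parabolicDomain X, (a p).IsSymm)
    (haP : LocUnifPosDefOn (parabolicDomain X) a)
    {w : EuclideanSpace ℝ (Fin n) × ℝ → ℝ} (hwc : ContinuousOn w (parabolicDomain X))
    (hw0 : ∀ p, 0 ≤ w p)
    (hw : ∀ C : Set (EuclideanSpace ℝ (Fin n) × ℝ), IsCompact C → C ⊆ parabolicDomain X →
      ∃ c B : ℝ, 0 < c ∧ 0 ≤ B ∧ ∀ p ∈ C, ∃ g,
        TouchingSupersolution (parabolicDomain X) (a p) c B w g p)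
    {x₁ x₂ : EuclideanSpace ℝ (Fin n)} {t₁ t₂ : ℝ} (hx₁ : x₁ ∈ X) (hx₂ : x₂ ∈ X) (ht₁ : 0 < t₁)
    (ht : t₁ < t₂) (hpos : 0 < w (x₁, t₁)) : 0 < w (x₂, t₂) := by
  let P : EuclideanSpace ℝ (Fin n) → EuclideanSpace ℝ (Fin n) → Prop := fun x y =>
    ∀ s t : ℝ, 0 < s → s < t → 0 < w (x, s) → 0 < w (y, t)
  have hP : P x₁ x₂ := by
    refine hXc.induction₂' P (fun x hx => ?_) (fun x y z _ _ _ hxy hyz s t hs hst h => ?_) hx₁ hx₂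
    · obtain ⟨r, hr, hrX⟩ := Metric.isOpen_iff.1 hXo x hx
      filter_upwards [nhdsWithin_le_nhds (Metric.ball_mem_nhds x hr)] with y hy
      have hseg : segment ℝ x y ⊆ X :=
        ((convex_ball x r).segment_subset (Metric.mem_ball_self hr) hy).trans hrX
      refine ⟨fun s t hs hst h => ?_, fun s t hs hst h => ?_⟩
      · exact pos_of_segment_subset hXo haB haS haP hwc hw0 hw hseg hs hst h
      · exact pos_of_segment_subset hXo haB haS haP hwc hw0 hw (segment_symm ℝ x y ▸ hseg) hs hst h
    · obtain ⟨r, hsr, hrt⟩ := exists_between hst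
      exact hyz r t (hs.trans hsr) hrt (hxy s r hs hsr h)
  exact hP t₁ t₂ ht₁ ht hpos

end ConvexSMP

/-! ### The strong maximum principle for convex sets. -/

theorem mainTheorem1 {n k : ℕ}
    (X : Set (EuclideanSpace ℝ (Fin n))) (hXo : IsOpen X) (hXc : IsConnected X)
    (a : EuclideanSpace ℝ (Fin n) × ℝ → Matrix (Fin n) (Fin n) ℝ)
    (D : EuclideanSpace ℝ (Fin n) × ℝ → EuclideanSpace ℝ (Fin k) →
      Matrix (Fin k) (Fin k) ℝ)
    (M : Fin n → EuclideanSpace ℝ (Fin n) × ℝ → EuclideanSpace ℝ (Fin k) →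
      Matrix (Fin k) (Fin k) ℝ)
    (φ : EuclideanSpace ℝ (Fin n) × ℝ → EuclideanSpace ℝ (Fin k) → EuclideanSpace ℝ (Fin k))
    (hφL : LipschitzLocUnif (parabolicDomain X) φ)
    (hDL : LipschitzLocUnif (parabolicDomain X) (fun p z => matOp (D p z)))
    (hML : ∀ i, LipschitzLocUnif (parabolicDomain X) (fun p z => matOp (M i p z)))
    (haB : ∀ i j, LocBoundedOn (parabolicDomain X) (fun p => a p i j))
    (hDB : LocBoundedOn (parabolicDomain X ×ˢ Set.univ) (fun q => matOp (D q.1 q.2)))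
    (hMB : ∀ i, LocBoundedOn (parabolicDomain X ×ˢ Set.univ) (fun q => matOp (M i q.1 q.2)))
    (haS : ∀ p ∈ parabolicDomain X, (a p).IsSymm)
    (haP : LocUnifPosDefOn (parabolicDomain X) a)
    (hDP : LocUnifPosDefOn
      (parabolicDomain X ×ˢ (Set.univ : Set (EuclideanSpace ℝ (Fin k))))
      (fun q => D q.1 q.2))
    (u : EuclideanSpace ℝ (Fin n) × ℝ → EuclideanSpace ℝ (Fin k))
    (hu : IsC21On u (parabolicDomain X))
    (huC : ContinuousOn u (closure (parabolicDomain X)))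
    (hueq : ∀ p ∈ parabolicDomain X,
      partialT u p = matOp (D p (u p)) (∑ i, ∑ j, a p i j • partialXX i j u p)
        + ∑ i, matOp (M i p (u p)) (partialX i u p) + φ p (u p))
    (K : Set (EuclideanSpace ℝ (Fin k))) (hKcl : IsClosed K) (hKcv : Convex ℝ K)
    (hK : IsCompatible (parabolicDomain X) K φ D M)
    (huK : ∀ p ∈ parabolicDomain X, u p ∈ K)
    (x₀ : EuclideanSpace ℝ (Fin n)) (t₀ : ℝ) (h₀ : (x₀, t₀) ∈ parabolicDomain X)
    (hbd : u (x₀, t₀) ∈ frontier K) :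
    ∀ x ∈ X, ∀ t ∈ Set.Icc 0 t₀, u (x, t) ∈ frontier K := by
  have hopen : IsOpen (parabolicDomain X) := hXo.prod isOpen_Ioi
  have huKcl : ∀ p ∈ closure (parabolicDomain X), u p ∈ K := fun p hp => by
    have := huC.image_closure (Set.mem_image_of_mem u hp)
    rw [← hKcl.closure_eq]
    exact closure_mono (Set.image_subset_iff.2 huK) this
  have hclos : ∀ x ∈ X, ∀ t ∈ Set.Icc 0 t₀,
      (x, t) ∈ closure (parabolicDomain X ∩ {q | q.2 < t₀}) := by
    intro x hx t ht
    have h1 : parabolicDomain X ∩ {q | q.2 < t₀} = X ×ˢ Set.Ioo 0 t₀ := by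
      ext q
      simp [parabolicDomain, and_assoc]
    rw [h1, closure_prod_eq, closure_Ioo h₀.2.ne]
    exact ⟨subset_closure hx, ht⟩
  -- If `K` has empty interior then `K` is its own frontier, and closedness of `K` with continuity
  -- of u gives the claim.
  rcases (interior K).eq_empty_or_nonempty with hempty | hint
  · intro x hx t ht
    rw [hKcl.frontier_eq, hempty, Set.sdiff_empty]
    exact huKcl _ (closure_mono Set.inter_subset_left (hclos x hx t ht))
  -- The whole space has empty frontier, contrary to `hbd`; without this the distance to the
  -- complement would be 0 by convention.
  have hne : (Kᶜ).Nonempty := by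
    rw [Set.nonempty_compl]
    rintro rfl
    simp at hbd
  have hbefore : ∀ p ∈ parabolicDomain X ∩ {q | q.2 < t₀}, u p ∈ frontier K := by
    rintro ⟨x, t⟩ ⟨hp, hlt⟩
    by_contra hnot
    have hpos := (infDist_compl_pos_iff hKcl hne (huK _ hp)).2 hnot
    have := pos_of_isPreconnected hXo hXc.isPreconnected haB haS haP
      (w := fun q => Metric.infDist (u q) Kᶜ)
      ((Metric.continuous_infDist_pt Kᶜ).comp_continuousOn hu.continuousOn)
      (fun _ => Metric.infDist_nonneg)
      (fun C hC hCΩ => exists_touchingSupersolution hφL hDL hML haB hDB hMB hDP hu hueq hKcl hKcv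
        hint hne hK huK hC hCΩ) hp.1 h₀.1 hp.2 hlt hpos
    exact (infDist_compl_pos_iff hKcl hne (huK _ h₀)).1 this hbd
  -- Propagation needs strictly later times, so it covers only 0 < t < t₀. The times 0 and t₀ follow
  -- by continuity of u up to the closure, as `frontier K` is closed.
  intro x hx t ht
  have hcont := huC.mono (closure_mono (Set.inter_subset_left (t := {q | q.2 < t₀})))
  have := hcont.image_closure (Set.mem_image_of_mem u (hclos x hx t ht))
  rw [← isClosed_frontier.closure_eq]
  exact closure_mono (Set.image_subset_iff.2 hbefore) this
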